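/- Let $\mathcal X$ be an uncountable Polish space with its Borel $\sigma$-algebra, let $\mathbb B(\mathcal X)$ be the space of bounded measurable functions $Z:\mathcal X\to\mathbb R$ and $\mathcal P(\mathcal X)$ the set of probability measures on $\mathcal X$. Let $\rho:\mathbb B(\mathcal X)\times\mathcal P(\mathcal X)\to\mathbb R$ satisfy, for all $P, P'\in\mathcal P(\mathcal X)$ and all $Z,Z',V\in\mathbb B(\mathcal X)$: (i) (normalized) $\rho[0,P]=0$; (ii) (translation equivariant) $\rho[a\mathbf 1+V,P]=a+\rho[V,P]$ for all $a\in\mathbb R$; (iii) (comonotonically convex) $\rho[\lambda Z+(1-\lambda)V,P]\le\lambda\rho[Z,P]+(1-\lambda)\rho[V,P]$ for all $\lambda\in[0,1]$ whenever $(Z(x')-Z(x))(V(x')-V(x))\ge 0$ for all $x,x'\in\mathcal X$; (iv) (consistent with the increasing convex order) $\rho[Z,P]\le\rho[Z',P']$ whenever $\int \max(0,Z-\eta)\,dP\le\int\max(0,Z'-\eta)\,dP'$ for all $\eta\in\mathbb R$. Let $\mathcal M$ be the set of finite countably additive measures on $(0,1]$, with the topology of weak convergence. Put $\Phi[Z,P](p)=\inf\{\eta\in\mathbb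 R: P[Z\le\eta]\ge p\}$ for $p\in(0,1]$, and for $\mu\in\mathcal M$ $$\rho^*(\mu)=\sup_{Z\in\mathbb B(\mathcal X),\,P\in\mathcal P(\mathcal X)}\Big\{\int_{(0,1]}\Phi[Z,P](p)\,\mu(dp)-\rho[Z,P]\Big\}\in\mathbb R\cup\{+\infty\}.$$ Call $\mathcal D$ a dual set of $\rho$ if it is a closed convex subset of $$\{\mu\in\mathcal M:\ \mu(0,\cdot]\text{ is nondecreasing and convex on }(0,1],\ \mu(0,1]=1\},$$ $\rho^*$ is finite on a dense subset of $\mathcal D$, and for all $Z\in\mathbb B(\mathcal X)$ and $P\in\mathcal P(\mathcal X)$ $$\rho[Z,P]=\sup_{\mu\in\mathcal D}\Big\{\int_{(0,1]}\Phi[Z,P](p)\,\mu(dp)-\rho^*(\mu)\Big\}$$ (measures with $\rho^*(\mu)=+\infty$ contribute $-\infty$). Then $\rho$ has a uniquely defined largest dual set $\mathcal D_\rho$, that is, a dual set that contains every dual set of $\rho$. If, additionally, $\rho[\beta V,P]=\beta\rho[V,P]$ for all $\beta\ge0$, $V\in\mathbb B(\mathcal X)$ and $P\in\mathcal P(\mathcal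 X)$, then $\rho^*(\mu)=0$ for all $\mu\in\mathcal D_\rho$. -/

import Mathlib

open MeasureTheory Set
open scoped NNReal

namespace RiskForm

noncomputable section

/-- The vector space `𝔹(X)` of all bounded measurable real functions on `X`. -/
def BddMeas (X : Type*) [MeasurableSpace X] : Submodule ℝ (X → ℝ) where
  carrier := {Z | Measurable Z ∧ ∃ c : ℝ, ∀ x, |Z x| ≤ c}
  zero_mem' := ⟨measurable_const, 0, fun x => by simp⟩
  add_mem' := by
    rintro V W ⟨hV, c, hc⟩ ⟨hW, d, hd⟩
    exact ⟨hV.add hW, c + d, fun x => (abs_add_le _ _).trans (add_le_add (hc x) (hd x))⟩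
  smul_mem' := by
    rintro a V ⟨hV, c, hc⟩
    refine ⟨hV.const_smul a, |a| * c, fun x => ?_⟩
    simp only [Pi.smul_apply, smul_eq_mul, abs_mul]
    exact mul_le_mul_of_nonneg_left (hc x) (abs_nonneg a)

/-- The function constantly equal to `1`. -/
def one (X : Type*) [MeasurableSpace X] : BddMeas X :=
  ⟨fun _ => 1, measurable_const, 1, fun _ => by simp⟩

/-- The space `𝓜` of finite (countably additive) measures on `(0,1]`, with the topology of
weak convergence of measures. -/
abbrev Meas01 : Type := FiniteMeasure (Ioc (0 : ℝ) 1)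

variable {X : Type*} [MeasurableSpace X]

def Normalized (ρ : BddMeas X → ProbabilityMeasure X → ℝ) : Prop :=
  ∀ P, ρ 0 P = 0

def TranslationEquivariant (ρ : BddMeas X → ProbabilityMeasure X → ℝ) : Prop :=
  ∀ (V : BddMeas X) (a : ℝ) (P : ProbabilityMeasure X), ρ (a • one X + V) P = a + ρ V P

def PositivelyHomogeneous (ρ : BddMeas X → ProbabilityMeasure X → ℝ) : Prop :=
  ∀ (V : BddMeas X) (β : ℝ), 0 ≤ β → ∀ P : ProbabilityMeasure X, ρ (β • V) P = β * ρ V P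

/-- The increasing convex order between probabilistic models `[Z,P]` and `[Z',P']`. -/
def IcxLE (Z : BddMeas X) (P : ProbabilityMeasure X)
    (Z' : BddMeas X) (P' : ProbabilityMeasure X) : Prop :=
  ∀ η : ℝ, ∫ x, max 0 (Z.1 x - η) ∂(P : Measure X) ≤ ∫ x, max 0 (Z'.1 x - η) ∂(P' : Measure X)

def IcxConsistent (ρ : BddMeas X → ProbabilityMeasure X → ℝ) : Prop :=
  ∀ (Z : BddMeas X) (P : ProbabilityMeasure X) (Z' : BddMeas X) (P' : ProbabilityMeasure X),
    IcxLE Z P Z' P' → ρ Z P ≤ ρ Z' P'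

def Comonotonic (Z V : BddMeas X) : Prop :=
  ∀ x x' : X, 0 ≤ (Z.1 x' - Z.1 x) * (V.1 x' - V.1 x)

def ComonotonicallyConvex (ρ : BddMeas X → ProbabilityMeasure X → ℝ) : Prop :=
  ∀ Z V : BddMeas X, Comonotonic Z V → ∀ (P : ProbabilityMeasure X) (l : ℝ), l ∈ Icc (0 : ℝ) 1 →
    ρ (l • Z + (1 - l) • V) P ≤ l * ρ Z P + (1 - l) * ρ V P

/-- The quantile function `Φ[Z,P](p) = inf {η : P[Z ≤ η] ≥ p}`, used for `p ∈ (0,1]`. -/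
def quantile (Z : BddMeas X) (P : ProbabilityMeasure X) (p : ℝ) : ℝ :=
  sInf {η : ℝ | p ≤ (P : Measure X).real {x | Z.1 x ≤ η}}

/-- The integral `∫ Φ[Z,P](p) μ(dp)` over `(0,1]`. -/
def quantileIntegral (Z : BddMeas X) (P : ProbabilityMeasure X) (μ : Meas01) : ℝ :=
  ∫ p : Ioc (0 : ℝ) 1, quantile Z P (p : ℝ) ∂(μ : Measure (Ioc (0 : ℝ) 1))

/-- The conjugate functional `ρ*` on finite measures on `(0,1]`, with values in `(-∞, +∞]`. -/
def conjugate (ρ : BddMeas X → ProbabilityMeasure X → ℝ) (μ : Meas01) : EReal :=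
  ⨆ (Z : BddMeas X) (P : ProbabilityMeasure X), ((quantileIntegral Z P μ - ρ Z P : ℝ) : EReal)

/-- The distribution function `p ↦ μ(0,p]`. -/
def distFun (μ : Meas01) (p : ℝ) : ℝ :=
  (μ : Measure (Ioc (0 : ℝ) 1)).real {s | (s : ℝ) ≤ p}

/-- The measures `μ` on `(0,1]` of total mass `1` for which `μ(0,·]` is nondecreasing and convex
on `(0,1]`. -/
def convexProb : Set Meas01 :=
  {μ | MonotoneOn (distFun μ) (Ioc 0 1) ∧ ConvexOn ℝ (Ioc 0 1) (distFun μ) ∧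
    (μ : Measure (Ioc (0 : ℝ) 1)) univ = 1}

/-- A closed convex set `D` of probability measures on `(0,1]` with convex distribution functions
represents `ρ` if `ρ[Z,P] = sup_{μ ∈ D} (∫ Φ[Z,P] dμ - ρ*(μ))` for all `[Z,P]`. Measures with
`ρ*(μ) = +∞` contribute `-∞` to the supremum; `D` must not contain superfluous ones, that is,
`ρ*` is finite on a dense subset of `D`. -/
structure IsDualSet (ρ : BddMeas X → ProbabilityMeasure X → ℝ) (D : Set Meas01) : Prop where
  subset_convexProb : D ⊆ convexProb
  isClosed : IsClosed D
  convex : Convex ℝ≥0 D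
  finite_dense : D ⊆ closure {μ ∈ D | conjugate ρ μ < ⊤}
  representation : ∀ (Z : BddMeas X) (P : ProbabilityMeasure X),
    (ρ Z P : EReal) = ⨆ μ ∈ D, ((quantileIntegral Z P μ : EReal) - conjugate ρ μ)

end

end RiskForm

open Filter Topology unitInterval

namespace RiskForm

/-! The largest dual set is the weak closure of `convexDomain ρ`, the measures of `convexProb` at
which the conjugate is finite. Maximality is immediate: a dual set lies in the closure of its points
of finite conjugate. `convexProb` is weakly closed and the domain is convex, so what remains is the
representation, which follows once every model has a subgradient in `convexProb`
(`exists_subgradient`).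

For subgradients, each model is sent to the continuous function `t ↦` average of its quantile
function over `(1-t,1]`. Pointwise order of these tail averages implies the increasing convex order,
so `ρ` is monotone in them. The functions strictly below the tail averages of some acceptable model
form an open set. It is convex because an uncountable Polish space carries a uniform variable `e`:
any two quantile functions are realized as nondecreasing functions of the same `e`, hence
comonotonically, and then mix linearly. Hahn-Banach separates this set from the tail averages of
`[Z,P]` shifted by `-ρ Z P`. The functional is positive, hence after normalization a probability
measure `ν` on `[0,1]`; mixing the uniform laws on `(1-t,1]` over `ν` gives a measure on `(0,1]`
with convex distribution function.

Under positive homogeneity, scaling forces `∫ Φ dμ ≤ ρ` on the domain. Left-continuity of quantile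
functions makes this integral weakly lower semicontinuous (`isClosed_integral_le`), so the bound
survives the closure and the conjugate is `0` there. -/

/-- The half-open unit interval `(0,1]`. -/
abbrev UnitIoc : Type := Ioc (0 : ℝ) 1

/-! ### The uniform law on `(0,1]`. -/

/-- The uniform distribution on `(0,1]`. -/
noncomputable def unif : Measure UnitIoc := (volume : Measure ℝ).comap Subtype.val

lemma unif_le (c : ℝ) :
    unif {s | (s : ℝ) ≤ c} = ENNReal.ofReal (min c 1) := by
  rw [unif, comap_subtype_coe_apply measurableSet_Ioc]
  have : (Subtype.val '' {s : UnitIoc | (s : ℝ) ≤ c}) = Ioc (0 : ℝ) (min c 1) := by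
    ext x
    simp only [mem_image, mem_ofPred_eq, Subtype.exists, mem_Ioc, exists_and_left, exists_prop,
      exists_eq_right_right, le_min_iff]
    tauto
  rw [this, Real.volume_Ioc, sub_zero]

instance : IsProbabilityMeasure unif := by
  constructor
  have h := unif_le 1
  rw [show {s : UnitIoc | (s : ℝ) ≤ 1} = univ from eq_univ_of_forall fun s => s.2.2] at h
  simpa using h

lemma unif_real_le (c : ℝ) :
    unif.real {s | (s : ℝ) ≤ c} = max 0 (min c 1) := by
  rw [measureReal_def, unif_le, ENNReal.toReal_ofReal', max_comm]

instance : NullSingletonClass unif := by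
  refine ⟨fun x => ?_⟩
  rw [unif, comap_subtype_coe_apply measurableSet_Ioc, image_singleton]
  simp

/-! ### Quantile functions and their realization by a uniform variable. -/

/-- Bounded nondecreasing left-continuous functions on `(0,1]`. -/
structure IsQuantileFn (h : UnitIoc → ℝ) : Prop where
  mono : Monotone h
  bdd : ∃ c, ∀ p, |h p| ≤ c
  left_cont : ∀ p, ContinuousWithinAt h (Iic p) p

namespace IsQuantileFn

variable {h k : UnitIoc → ℝ}

lemma measurable (hh : IsQuantileFn h) : Measurable h := hh.mono.measurable

lemma integrable (hh : IsQuantileFn h) {α : Type*} [MeasurableSpace α] {μ : Measure α}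
    [IsFiniteMeasure μ] {f : α → UnitIoc} (hf : Measurable f) :
    Integrable (fun x => h (f x)) μ := by
  obtain ⟨c, hc⟩ := hh.bdd
  exact Integrable.of_bound (hh.measurable.comp hf).aestronglyMeasurable c
    (Eventually.of_forall fun x => hc _)

lemma add (hh : IsQuantileFn h) (hk : IsQuantileFn k) : IsQuantileFn (fun p => h p + k p) := by
  obtain ⟨c, hc⟩ := hh.bdd
  obtain ⟨d, hd⟩ := hk.bdd
  exact ⟨hh.mono.add hk.mono, ⟨c + d, fun p => (abs_add_le _ _).trans (add_le_add (hc p) (hd p))⟩,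
    fun p => (hh.left_cont p).add (hk.left_cont p)⟩

lemma const_mul (hh : IsQuantileFn h) {a : ℝ} (ha : 0 ≤ a) : IsQuantileFn (fun p => a * h p) := by
  obtain ⟨c, hc⟩ := hh.bdd
  refine ⟨hh.mono.const_mul ha, ⟨a * c, fun p => ?_⟩, fun p => (hh.left_cont p).const_mul a⟩
  rw [abs_mul, abs_of_nonneg ha]
  exact mul_le_mul_of_nonneg_left (hc p) ha

lemma countable_not_continuousAt (hh : IsQuantileFn h) : {p | ¬ ContinuousAt h p}.Countable :=
  hh.mono.countable_not_continuousAt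

end IsQuantileFn

variable {X : Type*} [MeasurableSpace X]

section Quantile

variable (Z : BddMeas X) (P : ProbabilityMeasure X)

/-- Right-continuity of the distribution function makes the infimum attained. Boundedness of `Z`
with `0 < p ≤ 1` makes the defining set nonempty and bounded below, so `sInf` takes no default
value. Later facts about quantiles are read off from this Galois connection. -/
lemma quantile_le_iff {p : ℝ} (hp : p ∈ Ioc (0 : ℝ) 1) (η : ℝ) :
    quantile Z P p ≤ η ↔ p ≤ (P : Measure X).real {x | Z.1 x ≤ η} := by
  obtain ⟨hZ, c, hc⟩ := Z.2
  set F : ℝ → ℝ := fun η => (P : Measure X).real {x | Z.1 x ≤ η} with hF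
  have hmono : Monotone F := fun a b hab => measureReal_mono fun x hx => le_trans hx hab
  have hne : c ∈ {η | p ≤ F η} := by
    have : {x | Z.1 x ≤ c} = univ := eq_univ_of_forall fun x => (abs_le.1 (hc x)).2
    simpa [hF, this] using hp.2
  have hbdd : BddBelow {η | p ≤ F η} := by
    refine ⟨-c, fun y hy => ?_⟩
    by_contra! hlt
    have : {x | Z.1 x ≤ y} = ∅ := by
      ext x
      simp only [mem_ofPred_eq, mem_empty_iff_false, iff_false, not_le]
      exact hlt.trans_le (abs_le.1 (hc x)).1
    have h0 : p ≤ 0 := by simpa [hF, this] using hy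
    exact absurd hp.1 (not_lt.2 h0)
  have hcdf : ∀ y, F y = ProbabilityTheory.cdf ((P : Measure X).map Z.1) y := by
    intro y
    have : IsProbabilityMeasure ((P : Measure X).map Z.1) :=
      Measure.isProbabilityMeasure_map hZ.aemeasurable
    rw [ProbabilityTheory.cdf_eq_real, map_measureReal_apply hZ measurableSet_Iic]
    rfl
  have hmem : p ≤ F (quantile Z P p) := by
    have hrc : Tendsto F (𝓝[>] (quantile Z P p)) (𝓝 (F (quantile Z P p))) := by
      have := (ProbabilityTheory.cdf ((P : Measure X).map Z.1)).right_continuous (quantile Z P p)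
      have h2 := this.mono Ioi_subset_Ici_self
      rw [show F = _ from funext hcdf]
      exact h2
    refine ge_of_tendsto hrc (eventually_nhdsWithin_of_forall fun y hy => ?_)
    obtain ⟨z, hz, hzy⟩ := exists_lt_of_csInf_lt ⟨c, hne⟩ hy
    exact le_trans hz (hmono hzy.le)
  exact ⟨fun h => hmem.trans (hmono h), fun h => csInf_le hbdd h⟩

/-- The quantile function as a function on `(0,1]`. -/
noncomputable def quantileFn (p : UnitIoc) : ℝ := quantile Z P p

lemma quantileFn_le_iff (p : UnitIoc) (η : ℝ) :
    quantileFn Z P p ≤ η ↔ (p : ℝ) ≤ (P : Measure X).real {x | Z.1 x ≤ η} :=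
  quantile_le_iff Z P p.2 η

lemma isQuantileFn_quantileFn : IsQuantileFn (quantileFn Z P) := by
  have hmono : Monotone (quantileFn Z P) := fun p q hpq =>
    (quantileFn_le_iff Z P p _).2 (le_trans hpq ((quantileFn_le_iff Z P q _).1 le_rfl))
  refine ⟨hmono, ?_, fun p => ?_⟩
  · obtain ⟨hZ, c, hc⟩ := Z.2
    refine ⟨c, fun p => abs_le.2 ⟨?_, ?_⟩⟩
    · by_contra! hlt
      have h := (quantileFn_le_iff Z P p _).1 le_rfl
      have : {x | Z.1 x ≤ quantileFn Z P p} = ∅ := by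
        ext x
        simp only [mem_ofPred_eq, mem_empty_iff_false, iff_false, not_le]
        exact hlt.trans_le (abs_le.1 (hc x)).1
      rw [this, measureReal_empty] at h
      exact absurd p.2.1 (not_lt.2 h)
    · rw [quantileFn_le_iff]
      have : {x | Z.1 x ≤ c} = univ := eq_univ_of_forall fun x => (abs_le.1 (hc x)).2
      simpa [this] using p.2.2
  · refine tendsto_order.2 ⟨fun a ha => ?_, fun a ha => ?_⟩
    · have h1 : ¬ (p : ℝ) ≤ (P : Measure X).real {x | Z.1 x ≤ a} := by
        rw [← quantileFn_le_iff]; exact not_le.2 ha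
      have h2 : {q : UnitIoc | (P : Measure X).real {x | Z.1 x ≤ a} < q} ∈ 𝓝 p :=
        (isOpen_lt continuous_const continuous_subtype_val).mem_nhds (not_le.1 h1)
      filter_upwards [mem_nhdsWithin_of_mem_nhds h2] with q hq
      rw [← not_le, quantileFn_le_iff]
      exact not_le.2 hq
    · filter_upwards [self_mem_nhdsWithin] with q hq
      exact (hmono hq).trans_lt ha

lemma unif_quantileFn_le (η : ℝ) :
    unif.real {p | quantileFn Z P p ≤ η}
      = (P : Measure X).real {x | Z.1 x ≤ η} := by
  simp only [quantileFn_le_iff]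
  rw [unif_real_le, min_eq_left measureReal_le_one, max_eq_right measureReal_nonneg]

end Quantile

/-- Quantile functions compose with a measurable map to bounded measurable functions. -/
def IsQuantileFn.comp {h : UnitIoc → ℝ} (hh : IsQuantileFn h) {e : X → UnitIoc}
    (he : Measurable e) : BddMeas X :=
  ⟨fun x => h (e x), hh.measurable.comp he, hh.bdd.imp fun _ hc x => hc (e x)⟩

lemma IsQuantileFn.comonotonic_comp {h k : UnitIoc → ℝ} (hh : IsQuantileFn h)
    (hk : IsQuantileFn k) {e : X → UnitIoc} (he : Measurable e) :
    Comonotonic (hh.comp he) (hk.comp he) := by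
  intro x x'
  rcases le_total (e x) (e x') with hx | hx
  · exact mul_nonneg (sub_nonneg.2 (hh.mono hx)) (sub_nonneg.2 (hk.mono hx))
  · exact mul_nonneg_of_nonpos_of_nonpos (sub_nonpos.2 (hh.mono hx)) (sub_nonpos.2 (hk.mono hx))

/-- If `e` is uniformly distributed under `P`, then the quantile function of `h ∘ e` is `h`. -/
lemma IsQuantileFn.quantileFn_comp {h : UnitIoc → ℝ} (hh : IsQuantileFn h) {e : X → UnitIoc}
    (he : Measurable e) {P : ProbabilityMeasure X} (hP : (P : Measure X).map e = unif) :
    quantileFn (hh.comp he) P = h := by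
  have key : ∀ η, (P : Measure X).real {x | (hh.comp he).1 x ≤ η}
      = unif.real {p | h p ≤ η} := by
    intro η
    rw [← hP]
    exact (map_measureReal_apply he (hh.measurable measurableSet_Iic)).symm
  funext p
  refine eq_of_forall_ge_iff fun η => ?_
  rw [quantileFn_le_iff, key]
  constructor
  · intro hle
    by_contra! hlt
    have h1 : {q | η < h q} ∈ 𝓝[≤] p := (hh.left_cont p) (lt_mem_nhds hlt)
    -- Left-continuity moves the strict inequality to some `l < p`, so `{h ≤ η}` has uniform mass at
    -- most `l < p`. Taking the maximum with `p / 2` keeps `l` positive.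
    obtain ⟨l, hl, hlp, hsub⟩ : ∃ l : ℝ, 0 < l ∧ l < p ∧ ∀ q : UnitIoc, l < q → η < h q := by
      rw [mem_nhdsWithin_iff_exists_mem_nhds_inter] at h1
      obtain ⟨u, hu, hus⟩ := h1
      rw [nhds_subtype_eq_comap, mem_comap] at hu
      obtain ⟨v, hv, hvu⟩ := hu
      obtain ⟨l, hl, hlv⟩ := exists_Ioc_subset_of_mem_nhds hv ⟨0, p.2.1⟩
      have hl' : l < p := hl
      refine ⟨max l (p / 2), lt_max_of_lt_right (half_pos p.2.1),
        max_lt hl' (half_lt_self p.2.1), fun q hq => ?_⟩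
      rcases le_total q p with hqp | hqp
      · exact hus ⟨hvu (hlv ⟨(le_max_left _ _).trans_lt hq, hqp⟩), hqp⟩
      · exact hlt.trans_le (hh.mono hqp)
    have h2 : unif.real {q | h q ≤ η}
        ≤ unif.real {q | (q : ℝ) ≤ l} :=
      measureReal_mono fun q hq => not_lt.1 fun hlq => absurd (hsub q hlq) (not_lt.2 hq)
    rw [unif_real_le, min_eq_left (hlp.le.trans p.2.2), max_eq_right hl.le] at h2
    linarith
  · intro hle
    have h2 : unif.real {q | (q : ℝ) ≤ p}
        ≤ unif.real {q | h q ≤ η} :=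
      measureReal_mono fun q hq => (hh.mono (show q ≤ p from hq)).trans hle
    rwa [unif_real_le, min_eq_left p.2.2, max_eq_right p.2.1.le] at h2

lemma quantileFn_add_const (V : BddMeas X) (a : ℝ) (P : ProbabilityMeasure X) (p : UnitIoc) :
    quantileFn (a • one X + V) P p = a + quantileFn V P p := by
  refine eq_of_forall_ge_iff fun η => ?_
  rw [quantileFn_le_iff, add_comm a, ← le_sub_iff_add_le, quantileFn_le_iff]
  have : {x | (a • one X + V).1 x ≤ η} = {x | V.1 x ≤ η - a} := by
    ext x
    simp [one, le_sub_iff_add_le, add_comm]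
  rw [this]

lemma quantileFn_smul (V : BddMeas X) {b : ℝ} (hb : 0 < b) (P : ProbabilityMeasure X)
    (p : UnitIoc) : quantileFn (b • V) P p = b * quantileFn V P p := by
  refine eq_of_forall_ge_iff fun η => ?_
  rw [quantileFn_le_iff, ← le_div_iff₀' hb, quantileFn_le_iff]
  have : {x | (b • V).1 x ≤ η} = {x | V.1 x ≤ η / b} := by
    ext x
    simp [le_div_iff₀' hb]
  rw [this]

/-- The law of `Z` under `P` is that of its quantile function under the uniform distribution. -/
lemma map_quantileFn (Z : BddMeas X) (P : ProbabilityMeasure X) :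
    unif.map (quantileFn Z P) = (P : Measure X).map Z.1 := by
  have hq := (isQuantileFn_quantileFn Z P).measurable
  have hZ := Z.2.1
  have : IsProbabilityMeasure ((P : Measure X).map Z.1) :=
    Measure.isProbabilityMeasure_map hZ.aemeasurable
  have : IsProbabilityMeasure (unif.map (quantileFn Z P)) :=
    Measure.isProbabilityMeasure_map hq.aemeasurable
  refine Measure.ext_of_Iic _ _ fun η => ?_
  have h := unif_quantileFn_le Z P η
  rw [Measure.map_apply hq measurableSet_Iic, Measure.map_apply hZ measurableSet_Iic]
  exact (measureReal_eq_measureReal_iff).1 h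

/-! ### Tail averages and the increasing convex order. -/

lemma integral_stopLoss (Z : BddMeas X) (P : ProbabilityMeasure X) (η : ℝ) :
    ∫ x, max 0 (Z.1 x - η) ∂(P : Measure X) = ∫ p, max 0 (quantileFn Z P p - η) ∂unif := by
  have hq := (isQuantileFn_quantileFn Z P).measurable
  have hg : Measurable fun y : ℝ => max 0 (y - η) := by fun_prop
  have h1 := integral_map (μ := (P : Measure X)) Z.2.1.aemeasurable hg.aestronglyMeasurable
  have h2 := integral_map (μ := unif) hq.aemeasurable
    hg.aestronglyMeasurable
  rw [← h1, ← h2, map_quantileFn]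

/-- A monotone function has countably many discontinuities. Injectivity of `f y₀` keeps their
preimage countable, hence null, and dominated convergence applies. -/
lemma IsQuantileFn.continuousAt_integral {h : UnitIoc → ℝ} (hh : IsQuantileFn h)
    {Y : Type*} [TopologicalSpace Y] [FirstCountableTopology Y] {f : Y → UnitIoc → UnitIoc}
    (hf : ∀ y, Measurable (f y)) (hfc : ∀ s, Continuous fun y => f y s) {y₀ : Y}
    (hinj : Function.Injective (f y₀)) :
    ContinuousAt (fun y => ∫ s, h (f y s) ∂unif) y₀ := by
  obtain ⟨c, hc⟩ := hh.bdd
  refine continuousAt_of_dominated (bound := fun _ => c)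
    (Eventually.of_forall fun y => (hh.measurable.comp (hf y)).aestronglyMeasurable)
    (Eventually.of_forall fun y => Eventually.of_forall fun s => hc _) (integrable_const c) ?_
  have hnull : unif (f y₀ ⁻¹' {p | ¬ ContinuousAt h p}) = 0 :=
    (hh.countable_not_continuousAt.preimage_of_injOn hinj.injOn).measure_zero _
  filter_upwards [measure_eq_zero_iff_ae_notMem.1 hnull] with s hs
  have hs' : ContinuousAt h (f y₀ s) := by simpa using hs
  exact ContinuousAt.comp' (f := fun y => f y s) hs' (hfc s).continuousAt

/-- The point `1 - t (1 - s)` of `(0,1]`; as `s` ranges over `(0,1]` it runs over `(1-t,1]`. -/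
def upperPoint (t : I) (s : UnitIoc) : UnitIoc :=
  ⟨1 - t * (1 - s), by
    have h1 : (t : ℝ) * (1 - s) ≤ 1 - s := mul_le_of_le_one_left (sub_nonneg.2 s.2.2) t.2.2
    linarith [s.2.1], by
    have h1 : 0 ≤ (t : ℝ) * (1 - s) := mul_nonneg t.2.1 (sub_nonneg.2 s.2.2)
    linarith⟩

lemma continuous_upperPoint : Continuous fun x : I × UnitIoc => upperPoint x.1 x.2 := by
  unfold upperPoint
  fun_prop

lemma measurable_upperPoint : Measurable fun x : I × UnitIoc => upperPoint x.1 x.2 :=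
  continuous_upperPoint.measurable

lemma measurable_upperPoint_right (t : I) : Measurable (upperPoint t) :=
  (continuous_upperPoint.comp (Continuous.prodMk_right t)).measurable

lemma continuous_upperPoint_left (s : UnitIoc) : Continuous fun t => upperPoint t s :=
  continuous_upperPoint.comp (Continuous.prodMk_left s)

lemma upperPoint_zero (s : UnitIoc) : upperPoint 0 s = ⟨1, one_pos, le_rfl⟩ :=
  Subtype.ext (by simp [upperPoint])

lemma upperPoint_injective {t : I} (ht : 0 < (t : ℝ)) : Function.Injective (upperPoint t) := by
  intro s s' h
  have h1 : 1 - (t : ℝ) * (1 - s) = 1 - t * (1 - s') := congrArg Subtype.val h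
  have h2 : (t : ℝ) * (1 - s) = t * (1 - s') := by linarith
  have h3 := mul_left_cancel₀ ht.ne' h2
  exact Subtype.ext (by linarith)

lemma upperPoint_le_iff {t : I} (ht : 0 < (t : ℝ)) (s : UnitIoc) (c : ℝ) :
    (upperPoint t s : ℝ) ≤ c ↔ (s : ℝ) ≤ 1 - (1 - c) / t := by
  rw [le_sub_comm, div_le_iff₀' ht, sub_le_comm]
  rfl

/-- The average of `h` over its upper tail `(1-t,1]`; at `t = 0` this is `h 1`. -/
noncomputable def tailAvg (h : UnitIoc → ℝ) (t : I) : ℝ := ∫ s, h (upperPoint t s) ∂unif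

lemma IsQuantileFn.continuous_tailAvg {h : UnitIoc → ℝ} (hh : IsQuantileFn h) :
    Continuous (tailAvg h) := by
  refine continuous_iff_continuousAt.2 fun t => ?_
  rcases t.2.1.eq_or_lt with ht | ht
  · obtain ⟨c, hc⟩ := hh.bdd
    have ht0 : t = 0 := Subtype.ext ht.symm
    refine continuousAt_of_dominated (bound := fun _ => c)
      (Eventually.of_forall fun y =>
        (hh.measurable.comp (measurable_upperPoint_right y)).aestronglyMeasurable)
      (Eventually.of_forall fun y => Eventually.of_forall fun s => hc _) (integrable_const c)
      (Eventually.of_forall fun s => ?_)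
    -- At `t = 0` injectivity fails, but the only point reached is the top point `1`, where
    -- left-continuity is continuity.
    have h1 : ContinuousAt h (upperPoint t s) := by
      have h2 := hh.left_cont (upperPoint t s)
      have h3 : (Iic (upperPoint t s)) = univ :=
        eq_univ_of_forall fun q => by rw [ht0, upperPoint_zero]; exact q.2.2
      rwa [h3, continuousWithinAt_univ] at h2
    exact ContinuousAt.comp' (f := fun y => upperPoint y s) h1
      (continuous_upperPoint_left s).continuousAt
  · exact hh.continuousAt_integral measurable_upperPoint_right continuous_upperPoint_left
      (upperPoint_injective ht)

lemma map_upperPoint {t : I} (ht : 0 < (t : ℝ)) :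
    ENNReal.ofReal t • unif.map (upperPoint t) = unif.restrict {p | 1 - (t : ℝ) < p} := by
  have hS : MeasurableSet {p : UnitIoc | 1 - (t : ℝ) < p} :=
    measurableSet_lt measurable_const measurable_subtype_coe
  have : IsFiniteMeasure (unif.map (upperPoint t)) := Measure.isFiniteMeasure_map _ _
  have : IsFiniteMeasure (ENNReal.ofReal t • unif.map (upperPoint t)) :=
    Measure.smul_finite _ ENNReal.ofReal_ne_top
  refine Measure.ext_of_Iic _ _ fun c => ?_
  rw [Measure.smul_apply, smul_eq_mul,
    Measure.map_apply (measurable_upperPoint_right t) measurableSet_Iic,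
    Measure.restrict_apply measurableSet_Iic]
  have h1 : upperPoint t ⁻¹' Iic c = {s : UnitIoc | (s : ℝ) ≤ 1 - (1 - c) / t} := by
    ext s
    exact upperPoint_le_iff ht s c
  have h2 : unif (Iic c ∩ {p : UnitIoc | 1 - (t : ℝ) < p}) = ENNReal.ofReal (c - (1 - t)) := by
    rw [unif, comap_subtype_coe_apply measurableSet_Ioc]
    have : (Subtype.val '' (Iic c ∩ {p : UnitIoc | 1 - (t : ℝ) < p})) = Ioc (1 - (t : ℝ)) c := by
      ext x
      constructor
      · rintro ⟨p, ⟨h1, h2⟩, rfl⟩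
        exact ⟨h2, h1⟩
      · rintro ⟨h1, h2⟩
        exact ⟨⟨x, (sub_nonneg.2 t.2.2).trans_lt h1, h2.trans c.2.2⟩, ⟨h2, h1⟩, rfl⟩
    rw [this, Real.volume_Ioc]
  have h3 : 0 ≤ (1 - (c : ℝ)) / t := div_nonneg (sub_nonneg.2 c.2.2) ht.le
  rw [h1, h2, unif_le, min_eq_left (by linarith), ← ENNReal.ofReal_mul ht.le]
  congr 1
  field_simp
  ring

lemma setIntegral_upper {t : I} (ht : 0 < (t : ℝ)) {g : UnitIoc → ℝ} (hg : Measurable g) :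
    ∫ p in {p : UnitIoc | 1 - (t : ℝ) < p}, g p ∂unif = t * ∫ s, g (upperPoint t s) ∂unif := by
  rw [← map_upperPoint ht, integral_smul_measure, ENNReal.toReal_ofReal ht.le, smul_eq_mul,
    integral_map (measurable_upperPoint_right t).aemeasurable hg.aestronglyMeasurable]

lemma IsQuantileFn.setIntegral_upper_sub {h : UnitIoc → ℝ} (hh : IsQuantileFn h) {t : I}
    (ht : 0 < (t : ℝ)) (η : ℝ) :
    ∫ p in {p : UnitIoc | 1 - (t : ℝ) < p}, (h p - η) ∂unif = t * (tailAvg h t - η) := by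
  rw [setIntegral_upper ht (hh.measurable.sub_const η),
    integral_sub (hh.integrable (measurable_upperPoint_right t)) (integrable_const η)]
  simp [tailAvg]

/-- Pointwise domination of the tail averages implies the increasing convex order. -/
lemma icxLE_of_tailAvg_le {Z : BddMeas X}
    {P : ProbabilityMeasure X} {Z' : BddMeas X} {P' : ProbabilityMeasure X}
    (hle : ∀ t, tailAvg (quantileFn Z P) t ≤ tailAvg (quantileFn Z' P') t) : IcxLE Z P Z' P' := by
  intro η
  have hq := isQuantileFn_quantileFn Z P
  have hq' := isQuantileFn_quantileFn Z' P'
  rw [integral_stopLoss, integral_stopLoss]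
  -- At this level the positive part of `Φ[Z,P] - η` lives exactly on `(F,1]`. For the other model,
  -- integrating over `(F,1]` only bounds the stop-loss from below, which is the direction needed.
  set F := (P : Measure X).real {x | Z.1 x ≤ η} with hF
  have hF0 : 0 ≤ F := measureReal_nonneg
  have hF1 : F ≤ 1 := measureReal_le_one
  have hS : MeasurableSet {p : UnitIoc | F < p} :=
    measurableSet_lt measurable_const measurable_subtype_coe
  have hpos : ∀ q : UnitIoc → ℝ, IsQuantileFn q → Integrable (fun p => max 0 (q p - η)) unif :=
    fun q hq => by
      have h1 : Integrable (fun p => q p - η) unif :=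
        (hq.integrable (f := id) measurable_id).sub (integrable_const η)
      exact (integrable_zero _ _ _).sup h1
  have hlhs : ∫ p, max 0 (quantileFn Z P p - η) ∂unif
      = ∫ p in {p : UnitIoc | F < p}, (quantileFn Z P p - η) ∂unif := by
    rw [← integral_indicator hS]
    congr 1
    funext p
    have hp := quantileFn_le_iff Z P p η
    by_cases h : F < p
    · rw [indicator_of_mem (show p ∈ {p : UnitIoc | F < p} from h)]
      exact max_eq_right (sub_nonneg.2 (le_of_not_ge fun h' => absurd (hp.1 h') (not_le.2 h)))
    · rw [indicator_of_notMem (show p ∉ {p : UnitIoc | F < p} from h)]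
      exact max_eq_left (sub_nonpos.2 (hp.2 (not_lt.1 h)))
  have hrhs : ∫ p in {p : UnitIoc | F < p}, (quantileFn Z' P' p - η) ∂unif
      ≤ ∫ p, max 0 (quantileFn Z' P' p - η) ∂unif := by
    rw [← integral_indicator hS]
    refine integral_mono ?_ (hpos _ hq') fun p => ?_
    · exact ((hq'.integrable (f := id) measurable_id).sub (integrable_const η)).indicator hS
    · exact indicator_le' (fun p _ => le_max_right _ _) (fun p _ => le_max_left _ _) p
  rw [hlhs]
  refine le_trans ?_ hrhs
  rcases hF1.eq_or_lt with h1 | h1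
  · have : {p : UnitIoc | F < p} = ∅ := by
      ext p
      simpa [h1] using p.2.2
    simp [this]
  · have ht : F = 1 - ((⟨1 - F, by linarith, by linarith⟩ : I) : ℝ) := by simp
    rw [ht, hq.setIntegral_upper_sub (by simpa using h1),
      hq'.setIntegral_upper_sub (by simpa using h1)]
    have := hle ⟨1 - F, by linarith, by linarith⟩
    have h2 : 0 ≤ 1 - F := by linarith
    exact mul_le_mul_of_nonneg_left (by linarith) h2

/-- The tail averages of the quantile function of `[Z,P]` as a continuous function. -/
noncomputable def tailAvgMap (Z : BddMeas X) (P : ProbabilityMeasure X) : C(I, ℝ) :=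
  ⟨tailAvg (quantileFn Z P), (isQuantileFn_quantileFn Z P).continuous_tailAvg⟩

lemma tailAvg_const_add {h : UnitIoc → ℝ} (hh : IsQuantileFn h) (a : ℝ) (t : I) :
    tailAvg (fun p => a + h p) t = a + tailAvg h t := by
  unfold tailAvg
  rw [integral_add (integrable_const a) (hh.integrable (measurable_upperPoint_right t))]
  simp

lemma tailAvg_combination {h k : UnitIoc → ℝ} (hh : IsQuantileFn h) (hk : IsQuantileFn k)
    (a b : ℝ) (t : I) :
    tailAvg (fun p => a * h p + b * k p) t = a * tailAvg h t + b * tailAvg k t := by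
  unfold tailAvg
  rw [integral_add ((hh.integrable (measurable_upperPoint_right t)).const_mul a)
    ((hk.integrable (measurable_upperPoint_right t)).const_mul b), integral_const_mul,
    integral_const_mul]

lemma tailAvgMap_add_const (V : BddMeas X) (a : ℝ) (P : ProbabilityMeasure X) (t : I) :
    tailAvgMap (a • one X + V) P t = a + tailAvgMap V P t := by
  have : quantileFn (a • one X + V) P = fun p => a + quantileFn V P p :=
    funext (quantileFn_add_const V a P)
  change tailAvg _ t = _
  rw [this, tailAvg_const_add (isQuantileFn_quantileFn V P)]
  rfl

/-! ### Mixtures of uniform laws on upper tails. -/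

/-- For a probability measure `ν` on `[0,1]`, the mixture over `t` of the uniform distributions
on `(1-t,1]`. -/
noncomputable def tailMixture (ν : Measure I) [IsProbabilityMeasure ν] : Meas01 :=
  ⟨(ν.prod unif).map fun x => upperPoint x.1 x.2, Measure.isFiniteMeasure_map _ _⟩

section TailMixture

variable (ν : Measure I) [IsProbabilityMeasure ν]

lemma integral_tailMixture {h : UnitIoc → ℝ} (hh : IsQuantileFn h) :
    ∫ p, h p ∂(tailMixture ν : Measure UnitIoc) = ∫ t, tailAvg h t ∂ν := by
  change ∫ p, h p ∂((ν.prod unif).map fun x => upperPoint x.1 x.2) = _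
  rw [integral_map measurable_upperPoint.aemeasurable hh.measurable.aestronglyMeasurable,
    integral_prod _ (hh.integrable measurable_upperPoint)]
  rfl

lemma distFun_tailMixture (p : ℝ) :
    distFun (tailMixture ν) p = ∫ t, unif.real {s | (upperPoint t s : ℝ) ≤ p} ∂ν := by
  have hS : MeasurableSet {q : UnitIoc | (q : ℝ) ≤ p} :=
    measurableSet_le measurable_subtype_coe measurable_const
  have h1 : distFun (tailMixture ν) p = ((ν.prod unif).map fun x => upperPoint x.1 x.2).real
    {q : UnitIoc | (q : ℝ) ≤ p} := rfl
  rw [h1, map_measureReal_apply measurable_upperPoint hS, measureReal_def,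
    Measure.prod_apply (measurable_upperPoint hS), ← integral_toReal]
  · rfl
  · exact (measurable_measure_prodMk_left (measurable_upperPoint hS)).aemeasurable
  · exact Eventually.of_forall fun t => measure_lt_top _ _

/-- For `t > 0` this is the maximum of `0` and an affine function. For `t = 0` it jumps from `0` to
`1` at the endpoint `1`, which is harmless because `1` is an extreme point of `(0,1]`. -/
lemma convexOn_upperPoint (t : I) :
    ConvexOn ℝ (Ioc 0 1) fun p : ℝ => unif.real {s | (upperPoint t s : ℝ) ≤ p} := by
  refine ⟨convex_Ioc 0 1, fun x hx y hy a b ha hb hab => ?_⟩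
  simp only [smul_eq_mul]
  rcases t.2.1.eq_or_lt with ht | ht
  · have ht0 : t = 0 := Subtype.ext ht.symm
    subst ht0
    simp only [upperPoint_zero]
    by_cases h : 1 ≤ a * x + b * y
    · rcases ha.eq_or_lt with ha0 | ha0
      · have hb1 : b = 1 := by linarith
        simp [← ha0, hb1]
      rcases hb.eq_or_lt with hb0 | hb0
      · have ha1 : a = 1 := by linarith
        simp [← hb0, ha1]
      have h1 := hx.2
      have h2 := hy.2
      have hx1 : 1 ≤ x := by nlinarith
      have hy1 : 1 ≤ y := by nlinarith
      simp [h, hx1, hy1, hab]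
    · simp only [h]
      simp only [ofPred_false, measureReal_empty]
      positivity
  · simp only [upperPoint_le_iff ht]
    have hle : ∀ p ∈ Ioc (0 : ℝ) 1, unif.real {s : UnitIoc | (s : ℝ) ≤ 1 - (1 - p) / t}
        = max 0 (1 - (1 - p) / t) := fun p hp => by
      rw [unif_real_le, min_eq_left]
      have : 0 ≤ (1 - p) / t := div_nonneg (sub_nonneg.2 hp.2) ht.le
      linarith
    have hxy := (convex_Ioc (0 : ℝ) 1) hx hy ha hb hab
    simp only [smul_eq_mul] at hxy
    rw [hle x hx, hle y hy, hle _ hxy]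
    have e1 : 1 - (1 - (a * x + b * y)) / (t : ℝ)
        = a * (1 - (1 - x) / t) + b * (1 - (1 - y) / t) := by
      obtain rfl : b = 1 - a := by linarith
      field_simp
      ring
    rw [e1]
    refine max_le (by positivity) (add_le_add ?_ ?_)
    · exact mul_le_mul_of_nonneg_left (le_max_right _ _) ha
    · exact mul_le_mul_of_nonneg_left (le_max_right _ _) hb

lemma distFun_mono (μ : Meas01) : Monotone (distFun μ) := fun _ _ hab =>
  measureReal_mono fun _ hs => le_trans hs hab

lemma tailMixture_mem_convexProb : tailMixture ν ∈ convexProb := by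
  refine ⟨(distFun_mono _).monotoneOn _, ⟨convex_Ioc 0 1, fun x hx y hy a b ha hb hab => ?_⟩, ?_⟩
  · have hint : ∀ p : ℝ, Integrable (fun t => unif.real {s | (upperPoint t s : ℝ) ≤ p}) ν := by
      intro p
      have hS : MeasurableSet {q : UnitIoc | (q : ℝ) ≤ p} :=
        measurableSet_le measurable_subtype_coe measurable_const
      refine Integrable.of_bound (C := 1) ?_ (Eventually.of_forall fun t => ?_)
      · exact (measurable_measure_prodMk_left
          (measurable_upperPoint hS)).ennreal_toReal.aestronglyMeasurable
      · rw [Real.norm_eq_abs, abs_of_nonneg measureReal_nonneg]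
        exact measureReal_le_one
    simp only [distFun_tailMixture, smul_eq_mul]
    rw [← integral_const_mul, ← integral_const_mul,
      ← integral_add ((hint x).const_mul a) ((hint y).const_mul b)]
    exact integral_mono (hint _) (((hint x).const_mul a).add ((hint y).const_mul b))
      fun t => (convexOn_upperPoint t).2 hx hy ha hb hab
  · have : IsProbabilityMeasure ((ν.prod unif).map fun x => upperPoint x.1 x.2) :=
      Measure.isProbabilityMeasure_map measurable_upperPoint.aemeasurable
    exact this.measure_univ

end TailMixture

/-! ### Separation in `C([0,1])` and subgradients. -/

/-- A normalized positive linear functional on `C(K)` is integration against a probability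
measure. -/
lemma exists_probabilityMeasure_integral_eq {K : Type*} [TopologicalSpace K] [CompactSpace K]
    [T2Space K] [MeasurableSpace K] [BorelSpace K] (ℓ : C(K, ℝ) →ₗ[ℝ] ℝ)
    (hpos : ∀ f : C(K, ℝ), (∀ x, 0 ≤ f x) → 0 ≤ ℓ f) (hone : ℓ 1 = 1) :
    ∃ ν : Measure K, IsProbabilityMeasure ν ∧ ∀ f : C(K, ℝ), ∫ x, f x ∂ν = ℓ f := by
  let L : CompactlySupportedContinuousMap K ℝ →ₗ[ℝ] ℝ :=
    { toFun := fun f => ℓ f.toContinuousMap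
      map_add' := fun f g => ℓ.map_add f.toContinuousMap g.toContinuousMap
      map_smul' := fun a f => ℓ.map_smul a f.toContinuousMap }
  let Λ : CompactlySupportedContinuousMap K ℝ →ₚ[ℝ] ℝ :=
    PositiveLinearMap.mk₀ L fun f hf => hpos _ fun x => hf x
  have hint : ∀ f : C(K, ℝ), ∫ x, f x ∂(RealRMK.rieszMeasure Λ) = ℓ f := fun f =>
    RealRMK.integral_rieszMeasure Λ (CompactlySupportedContinuousMap.continuousMapEquiv f)
  refine ⟨RealRMK.rieszMeasure Λ, ⟨?_⟩, hint⟩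
  have h1 := hint 1
  rw [hone] at h1
  simp only [ContinuousMap.one_apply, integral_const, smul_eq_mul, mul_one, measureReal_def] at h1
  rwa [ENNReal.toReal_eq_one_iff] at h1

lemma not_countable_unitIoc : ¬ Countable UnitIoc := fun _ => by
  have h := (countable_univ (α := UnitIoc)).measure_zero unif
  rw [measure_univ] at h
  exact one_ne_zero h

variable {ρ : BddMeas X → ProbabilityMeasure X → ℝ}

/-- An uncountable standard Borel space carries a uniformly distributed random variable. -/
lemma exists_map_eq_unif [StandardBorelSpace X] [Uncountable X] :
    ∃ (e : X → UnitIoc) (Q : ProbabilityMeasure X),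
      Measurable e ∧ (Q : Measure X).map e = unif := by
  have : StandardBorelSpace UnitIoc := measurableSet_Ioc.standardBorel
  let e : X ≃ᵐ UnitIoc :=
    PolishSpace.measurableEquivOfNotCountable (not_countable_iff.2 ‹_›) not_countable_unitIoc
  refine ⟨e, ⟨unif.map e.symm, Measure.isProbabilityMeasure_map e.symm.measurable.aemeasurable⟩,
    e.measurable, ?_⟩
  change (unif.map e.symm).map e = unif
  rw [Measure.map_map e.measurable e.symm.measurable]
  simp

lemma IcxConsistent.le_of_tailAvgMap_le (hicx : IcxConsistent ρ) {Z Z' : BddMeas X}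
    {P P' : ProbabilityMeasure X} (h : ∀ t, tailAvgMap Z P t ≤ tailAvgMap Z' P' t) :
    ρ Z P ≤ ρ Z' P' :=
  hicx _ _ _ _ (icxLE_of_tailAvg_le h)

/-- The continuous functions lying strictly below the tail averages of an acceptable model. -/
def acceptanceSet (ρ : BddMeas X → ProbabilityMeasure X → ℝ) : Set C(I, ℝ) :=
  {f | ∃ δ > 0, ∃ Z P, ρ Z P ≤ 0 ∧ ∀ t, f t + δ ≤ tailAvgMap Z P t}

lemma isOpen_acceptanceSet (ρ : BddMeas X → ProbabilityMeasure X → ℝ) :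
    IsOpen (acceptanceSet ρ) := by
  refine Metric.isOpen_iff.2 fun f hf => ?_
  obtain ⟨δ, hδ, Z, P, hZ, hle⟩ := hf
  refine ⟨δ / 2, half_pos hδ, fun g hg => ⟨δ / 2, half_pos hδ, Z, P, hZ, fun t => ?_⟩⟩
  have h1 : dist (g t) (f t) < δ / 2 := (ContinuousMap.dist_apply_le_dist t).trans_lt hg
  rw [Real.dist_eq] at h1
  linarith [(abs_lt.1 h1).2, hle t]

/-- Both models are replaced by their quantile functions composed with `e`. This keeps the tail
averages, hence acceptability, and makes the positions comonotonic under one measure `Q`, so that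
comonotonic convexity applies although the original models need not share a measure. -/
lemma convex_acceptanceSet (hconv : ComonotonicallyConvex ρ) (hicx : IcxConsistent ρ)
    {e : X → UnitIoc} (he : Measurable e) {Q : ProbabilityMeasure X}
    (hQ : (Q : Measure X).map e = unif) : Convex ℝ (acceptanceSet ρ) := by
  rintro f ⟨δ, hδ, Z, P, hZ, hf⟩ g ⟨ε, hε, V, R, hV, hg⟩ a b ha hb hab
  have hz := isQuantileFn_quantileFn Z P
  have hv := isQuantileFn_quantileFn V R
  have hw := (hz.const_mul ha).add (hv.const_mul hb)
  have hZQ : ρ (hz.comp he) Q ≤ 0 := (hicx.le_of_tailAvgMap_le fun t => by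
    change tailAvg (quantileFn (hz.comp he) Q) t ≤ _
    rw [hz.quantileFn_comp he hQ]
    exact le_rfl).trans hZ
  have hVQ : ρ (hv.comp he) Q ≤ 0 := (hicx.le_of_tailAvgMap_le fun t => by
    change tailAvg (quantileFn (hv.comp he) Q) t ≤ _
    rw [hv.quantileFn_comp he hQ]
    exact le_rfl).trans hV
  have hb' : b = 1 - a := by linarith
  have hW : hw.comp he = a • hz.comp he + (1 - a) • hv.comp he := by
    rw [← hb']
    rfl
  refine ⟨min δ ε, lt_min hδ hε, hw.comp he, Q, ?_, fun t => ?_⟩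
  · rw [hW]
    refine (hconv _ _ (hz.comonotonic_comp hv he) Q a ⟨ha, by linarith⟩).trans ?_
    rw [← hb']
    exact add_nonpos (mul_nonpos_of_nonneg_of_nonpos ha hZQ) (mul_nonpos_of_nonneg_of_nonpos hb hVQ)
  · change a * f t + b * g t + min δ ε ≤ tailAvg (quantileFn (hw.comp he) Q) t
    rw [hw.quantileFn_comp he hQ, tailAvg_combination hz hv]
    have h1 : a * (f t + min δ ε) ≤ a * tailAvg (quantileFn Z P) t :=
      mul_le_mul_of_nonneg_left ((add_le_add le_rfl (min_le_left _ _)).trans (hf t)) ha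
    have h2 : b * (g t + min δ ε) ≤ b * tailAvg (quantileFn V R) t :=
      mul_le_mul_of_nonneg_left ((add_le_add le_rfl (min_le_right _ _)).trans (hg t)) hb
    have h3 : min δ ε = a * min δ ε + b * min δ ε := by rw [← add_mul, hab, one_mul]
    linarith

/-- A linear functional bounded above on a nonempty set that is closed under passing to smaller
functions is positive. -/
lemma nonneg_of_bddAbove_lowerSet {K : Type*} [TopologicalSpace K] {A : Set C(K, ℝ)}
    (hne : A.Nonempty) (hlow : ∀ f ∈ A, ∀ g : C(K, ℝ), (∀ t, g t ≤ f t) → g ∈ A)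
    (ℓ : C(K, ℝ) →ₗ[ℝ] ℝ) {M : ℝ} (hM : ∀ f ∈ A, ℓ f ≤ M) (f : C(K, ℝ)) (hf : ∀ t, 0 ≤ f t) :
    0 ≤ ℓ f := by
  obtain ⟨g, hg⟩ := hne
  by_contra! hneg
  have key : ∀ n : ℕ, ℓ g - n * ℓ f ≤ M := fun n => by
    -- Were `ℓ f` negative, moving down along `-f` would send `ℓ` to infinity within `A`.
    have h1 := hM (g - (n : ℝ) • f) (hlow g hg _ fun t => by
      have := mul_nonneg n.cast_nonneg (hf t)
      simp only [ContinuousMap.sub_apply, ContinuousMap.smul_apply, smul_eq_mul]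
      linarith)
    simpa using h1
  obtain ⟨n, hn⟩ := exists_nat_gt ((M - ℓ g) / (-ℓ f))
  rw [div_lt_iff₀ (neg_pos.2 hneg)] at hn
  linarith [key n]

/-- At every model the risk form has a subgradient given by a probability measure on `(0,1]` with
convex distribution function. -/
lemma exists_subgradient (htrans : TranslationEquivariant ρ)
    (hconv : ComonotonicallyConvex ρ) (hicx : IcxConsistent ρ) {e : X → UnitIoc}
    (he : Measurable e) {Q : ProbabilityMeasure X} (hQ : (Q : Measure X).map e = unif)
    (Z : BddMeas X) (P : ProbabilityMeasure X) :
    ∃ μ ∈ convexProb, ∀ V R,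
      quantileIntegral V R μ - ρ V R ≤ quantileIntegral Z P μ - ρ Z P := by
  set f₀ : C(I, ℝ) := tailAvgMap Z P - (ρ Z P) • 1 with hf₀
  have hnot : f₀ ∉ acceptanceSet ρ := by
    rintro ⟨δ, hδ, V, R, hV, hle⟩
    -- The shifted model has risk exactly `δ > 0`, yet it would be dominated by an acceptable one.
    have h1 := hicx.le_of_tailAvgMap_le (Z := (δ - ρ Z P) • one X + Z) (P := P) (Z' := V)
      (P' := R) fun t => by
        rw [tailAvgMap_add_const]
        have := hle t
        simp only [hf₀, ContinuousMap.sub_apply, ContinuousMap.smul_apply,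
          ContinuousMap.one_apply, smul_eq_mul, mul_one] at this
        linarith
    rw [htrans] at h1
    linarith
  obtain ⟨L, hL⟩ := geometric_hahn_banach_open_point (convex_acceptanceSet hconv hicx he hQ)
    (isOpen_acceptanceSet ρ) hnot
  have hmem : ∀ V R, ∀ δ > 0, tailAvgMap V R - (ρ V R + δ) • 1 ∈ acceptanceSet ρ := by
    intro V R δ hδ
    refine ⟨δ, hδ, (-ρ V R) • one X + V, R, by rw [htrans]; simp, fun t => ?_⟩
    rw [tailAvgMap_add_const]
    simp only [ContinuousMap.sub_apply, ContinuousMap.smul_apply, ContinuousMap.one_apply,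
      smul_eq_mul, mul_one]
    linarith
  have hne : (acceptanceSet ρ).Nonempty := ⟨_, hmem Z P 1 one_pos⟩
  have hlow : ∀ f ∈ acceptanceSet ρ, ∀ g : C(I, ℝ), (∀ t, g t ≤ f t) → g ∈ acceptanceSet ρ := by
    rintro f ⟨δ, hδ, V, R, hV, hle⟩ g hg
    exact ⟨δ, hδ, V, R, hV, fun t => (add_le_add (hg t) le_rfl).trans (hle t)⟩
  have hpos : ∀ f : C(I, ℝ), (∀ t, 0 ≤ f t) → 0 ≤ L f :=
    nonneg_of_bddAbove_lowerSet hne hlow L.toLinearMap fun f hf => (hL f hf).le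
  have hone : 0 < L 1 := by
    have h1 := hL _ (hmem Z P 1 one_pos)
    -- Strict separation of `f₀ - 1` from `f₀` gives `L 1 > 0`, which permits normalization.
    have h2 : tailAvgMap Z P - (ρ Z P + 1) • 1 = f₀ - 1 := by
      rw [hf₀, add_smul, one_smul]; abel
    rw [h2, map_sub] at h1
    linarith
  obtain ⟨ν, hν, hint⟩ := exists_probabilityMeasure_integral_eq ((L 1)⁻¹ • L.toLinearMap)
    (fun f hf => mul_nonneg (inv_nonneg.2 hone.le) (hpos f hf)) (inv_mul_cancel₀ hone.ne')
  have hqi : ∀ (V : BddMeas X) R, quantileIntegral V R (tailMixture ν) = (L 1)⁻¹ * L (tailAvgMap V R) :=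
    fun V R => by
      rw [show quantileIntegral V R (tailMixture ν) = _ from
        integral_tailMixture ν (isQuantileFn_quantileFn V R)]
      exact hint (tailAvgMap V R)
  refine ⟨tailMixture ν, tailMixture_mem_convexProb ν, fun V R => ?_⟩
  -- The slack `δ` is needed because the acceptance set is strict; it disappears in the limit.
  refine le_of_forall_pos_le_add fun δ hδ => ?_
  have h1 := hL _ (hmem V R δ hδ)
  rw [hf₀, map_sub, map_sub, map_smul, map_smul, smul_eq_mul, smul_eq_mul] at h1
  rw [hqi, hqi]
  have h2 := mul_le_mul_of_nonneg_left h1.le (inv_nonneg.2 hone.le)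
  have h3 : (L 1)⁻¹ * L 1 = 1 := inv_mul_cancel₀ hone.ne'
  have h4 : ∀ x y : ℝ, (L 1)⁻¹ * (x - y * L 1) = (L 1)⁻¹ * x - y := fun x y => by
    rw [mul_sub, mul_left_comm, h3, mul_one]
  rw [h4, h4] at h2
  linarith

/-! ### Topology of the set of measures -/

/-- A continuous piecewise linear function which is `1` on `(-∞,x]` and `0` on `[x+h,∞)`. -/
noncomputable def ramp (x h s : ℝ) : ℝ := max 0 (min 1 ((x + h - s) / h))

lemma ramp_mem (x h s : ℝ) : ramp x h s ∈ Icc (0 : ℝ) 1 :=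
  ⟨le_max_left _ _, max_le zero_le_one (min_le_left _ _)⟩

lemma ramp_of_le {x h s : ℝ} (hh : 0 < h) (hs : s ≤ x) : ramp x h s = 1 := by
  have h1 : 1 ≤ (x + h - s) / h := (one_le_div hh).2 (by linarith)
  rw [ramp, min_eq_left h1, max_eq_right zero_le_one]

lemma ramp_of_ge {x h s : ℝ} (hh : 0 < h) (hs : x + h ≤ s) : ramp x h s = 0 := by
  have h1 : (x + h - s) / h ≤ 0 := div_nonpos_of_nonpos_of_nonneg (by linarith) hh.le
  exact max_eq_left ((min_le_right _ _).trans h1)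

lemma continuous_ramp (x h : ℝ) : Continuous (ramp x h) := by
  unfold ramp
  fun_prop

lemma continuous_integral_of_bounded {Ω : Type*} [TopologicalSpace Ω] [MeasurableSpace Ω]
    [OpensMeasurableSpace Ω] {f : Ω → ℝ} (hf : Continuous f) {c : ℝ} (hc : ∀ x, |f x| ≤ c) :
    Continuous fun μ : FiniteMeasure Ω => ∫ x, f x ∂(μ : Measure Ω) :=
  FiniteMeasure.continuous_integral_boundedContinuousFunction
    (BoundedContinuousFunction.ofNormedAddCommGroup f hf c hc)

lemma integrable_ramp (μ : Meas01) (x h : ℝ) :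
    Integrable (fun s : UnitIoc => ramp x h s) (μ : Measure UnitIoc) :=
  Integrable.of_bound ((continuous_ramp x h).comp continuous_subtype_val).aestronglyMeasurable 1
    (Eventually.of_forall fun s => by
      rw [Real.norm_eq_abs, abs_of_nonneg (ramp_mem _ _ _).1]; exact (ramp_mem _ _ _).2)

lemma measurableSet_le_unitIoc (p : ℝ) : MeasurableSet {s : UnitIoc | (s : ℝ) ≤ p} :=
  measurableSet_le measurable_subtype_coe measurable_const

lemma distFun_eq_integral (μ : Meas01) (p : ℝ) :
    distFun μ p = ∫ s, {s : UnitIoc | (s : ℝ) ≤ p}.indicator (fun _ => (1 : ℝ)) s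
      ∂(μ : Measure UnitIoc) := by
  rw [integral_indicator (measurableSet_le_unitIoc p)]
  simp [distFun]

lemma integrable_indicator_le (μ : Meas01) (p : ℝ) :
    Integrable ({s : UnitIoc | (s : ℝ) ≤ p}.indicator fun _ => (1 : ℝ)) (μ : Measure UnitIoc) :=
  (integrable_const 1).indicator (measurableSet_le_unitIoc p)

lemma distFun_le_integral_ramp (μ : Meas01) (x : ℝ) {h : ℝ} (hh : 0 < h) :
    distFun μ x ≤ ∫ s : UnitIoc, ramp x h s ∂(μ : Measure UnitIoc) := by
  rw [distFun_eq_integral]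
  refine integral_mono (integrable_indicator_le μ x) (integrable_ramp μ x h) fun s => ?_
  refine indicator_le' (fun s hs => ?_) (fun s _ => (ramp_mem _ _ _).1) s
  exact (ramp_of_le hh hs).ge

lemma integral_ramp_le_distFun (μ : Meas01) (x : ℝ) {h : ℝ} (hh : 0 < h) :
    ∫ s : UnitIoc, ramp x h s ∂(μ : Measure UnitIoc) ≤ distFun μ (x + h) := by
  rw [distFun_eq_integral]
  refine integral_mono (integrable_ramp μ x h) (integrable_indicator_le μ _) fun s => ?_
  by_cases hs : (s : ℝ) ≤ x + h
  · rw [indicator_of_mem (show s ∈ {s : UnitIoc | (s : ℝ) ≤ x + h} from hs)]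
    exact (ramp_mem _ _ _).2
  · rw [indicator_of_notMem (show s ∉ {s : UnitIoc | (s : ℝ) ≤ x + h} from hs)]
    exact (ramp_of_ge hh (not_le.1 hs).le).le

lemma tendsto_distFun_right (μ : Meas01) (x : ℝ) :
    Tendsto (distFun μ) (𝓝[>] x) (𝓝 (distFun μ x)) := by
  have h1 : Tendsto (fun y => (μ : Measure UnitIoc) {s : UnitIoc | (s : ℝ) ≤ y}) (𝓝[>] x)
      (𝓝 ((μ : Measure UnitIoc) (⋂ y > x, {s : UnitIoc | (s : ℝ) ≤ y}))) :=
    tendsto_measure_biInter_gt (fun y _ => (measurableSet_le_unitIoc y).nullMeasurableSet)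
      (fun y z _ hyz s hs => le_trans hs hyz) ⟨x + 1, by simp, measure_ne_top _ _⟩
  have h2 : (⋂ y > x, {s : UnitIoc | (s : ℝ) ≤ y}) = {s : UnitIoc | (s : ℝ) ≤ x} := by
    ext s
    simp only [mem_iInter, mem_ofPred_eq]
    exact ⟨fun h => le_of_forall_gt_imp_ge_of_dense h, fun h y hy => h.trans (le_of_lt hy)⟩
  rw [h2] at h1
  exact (ENNReal.tendsto_toReal (measure_ne_top _ _)).comp h1

lemma distFun_min_one (μ : Meas01) (p : ℝ) : distFun μ (min p 1) = distFun μ p := by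
  unfold distFun
  congr 1
  ext s
  simp only [mem_ofPred_eq, le_min_iff]
  exact ⟨fun h => h.1, fun h => ⟨h, s.2.2⟩⟩

/-- Distribution functions are not weakly continuous, so the convexity inequality is sandwiched
between integrals of ramps, which are; the price is a shift of the arguments on the right by `2h`.
-/
lemma distFun_le_of_mem_closure_convexProb {μ : Meas01} (hμ : μ ∈ closure convexProb) {x y : ℝ}
    (hx : x ∈ Ioc (0 : ℝ) 1) (hy : y ∈ Ioc (0 : ℝ) 1) (hxy : x < y) {a b : ℝ} (ha : 0 < a)
    (hb : 0 < b) (hab : a + b = 1) {h : ℝ} (hh : 0 < h) :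
    distFun μ (a * x + b * y) ≤ a * distFun μ (x + h + h) + b * distFun μ (y + h + h) := by
  set x' := min (x + h) 1 with hx'
  set y' := min (y + h) 1 with hy'
  have hx1 : x < x' := lt_min (by linarith) (hxy.trans_le hy.2)
  have hy1 : y ≤ y' := le_min (by linarith) hy.2
  have hx2 : x' ∈ Ioc (0 : ℝ) 1 := ⟨hx.1.trans hx1, min_le_right _ _⟩
  have hy2 : y' ∈ Ioc (0 : ℝ) 1 := ⟨hy.1.trans_le hy1, min_le_right _ _⟩
  -- The left ramp must reach `0` at `a x' + b y'`. Its width is positive even if `y = 1` forces `y'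
  -- = y`, since `x < y ≤ 1` gives `x < x'`.
  set d := a * x' + b * y' - (a * x + b * y) with hd
  have hd0 : 0 < d := by
    have h1 := mul_lt_mul_of_pos_left hx1 ha
    have h2 := mul_le_mul_of_nonneg_left hy1 hb.le
    linarith
  have hcont : ∀ x h : ℝ, Continuous fun μ : Meas01 =>
      ∫ s : UnitIoc, ramp x h s ∂(μ : Measure UnitIoc) := fun x h =>
    continuous_integral_of_bounded (f := fun s : UnitIoc => ramp x h s) (c := 1)
      ((continuous_ramp x h).comp continuous_subtype_val)
      fun s => by rw [abs_of_nonneg (ramp_mem _ _ _).1]; exact (ramp_mem _ _ _).2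
  have hcl : IsClosed {μ : Meas01 |
      ∫ s : UnitIoc, ramp (a * x + b * y) d s ∂(μ : Measure UnitIoc)
        ≤ a * ∫ s : UnitIoc, ramp (x + h) h s ∂(μ : Measure UnitIoc)
          + b * ∫ s : UnitIoc, ramp (y + h) h s ∂(μ : Measure UnitIoc)} :=
    isClosed_le (hcont _ _) (((hcont _ _).const_mul a).add ((hcont _ _).const_mul b))
  have hmem := closure_minimal (fun κ hκ => ?_) hcl hμ
  · refine (distFun_le_integral_ramp μ _ hd0).trans (le_trans hmem ?_)
    exact add_le_add (mul_le_mul_of_nonneg_left (integral_ramp_le_distFun μ _ hh) ha.le)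
      (mul_le_mul_of_nonneg_left (integral_ramp_le_distFun μ _ hh) hb.le)
  · have h1 := hκ.2.1.2 hx2 hy2 ha.le hb.le hab
    simp only [smul_eq_mul] at h1
    rw [hx', hy', distFun_min_one, distFun_min_one, ← hx', ← hy'] at h1
    have h2 := integral_ramp_le_distFun κ (a * x + b * y) hd0
    rw [hd, add_sub_cancel] at h2
    refine h2.trans (h1.trans (add_le_add ?_ ?_))
    · exact mul_le_mul_of_nonneg_left (distFun_le_integral_ramp κ _ hh) ha.le
    · exact mul_le_mul_of_nonneg_left (distFun_le_integral_ramp κ _ hh) hb.le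

/-- Letting `h` decrease to `0` in the relaxed inequality recovers convexity, by right-continuity of
`distFun μ`. Total mass is weakly continuous. -/
lemma isClosed_convexProb : IsClosed convexProb := by
  refine isClosed_of_closure_subset fun μ hμ => ⟨(distFun_mono μ).monotoneOn _, ?_, ?_⟩
  · refine LinearOrder.convexOn_of_lt (convex_Ioc 0 1) fun x hx y hy hxy a b ha hb hab => ?_
    have hshift : ∀ z : ℝ, Tendsto (fun h => distFun μ (z + h + h)) (𝓝[>] 0)
        (𝓝 (distFun μ z)) := fun z => by
      refine (tendsto_distFun_right μ z).comp (tendsto_nhdsWithin_iff.2 ⟨?_, ?_⟩)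
      · have h1 : Continuous fun h : ℝ => z + h + h := by fun_prop
        have h2 := h1.tendsto 0
        simp only [add_zero] at h2
        exact h2.mono_left nhdsWithin_le_nhds
      · filter_upwards [self_mem_nhdsWithin] with h hh
        have : 0 < h := hh
        show z < z + h + h
        linarith
    refine ge_of_tendsto (((hshift x).const_mul a).add ((hshift y).const_mul b)) ?_
    filter_upwards [self_mem_nhdsWithin] with h hh
    exact distFun_le_of_mem_closure_convexProb hμ hx hy hxy ha hb hab hh
  · have hcl : IsClosed {μ : Meas01 | μ.mass = 1} :=
      isClosed_eq FiniteMeasure.continuous_mass continuous_const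
    have h1 : μ.mass = 1 := closure_minimal (fun κ hκ => by
      have h2 := hκ.2.2
      rw [← FiniteMeasure.ennreal_mass] at h2
      exact_mod_cast h2) hcl hμ
    rw [← FiniteMeasure.ennreal_mass, h1, ENNReal.coe_one]

/-! ### Left averages and lower semicontinuity of quantile integrals. -/

/-- The product of two points of `(0,1]`. -/
def mulPoint (p q : UnitIoc) : UnitIoc :=
  ⟨p * q, mul_pos p.2.1 q.2.1, mul_le_one₀ p.2.2 q.2.1.le q.2.2⟩

lemma continuous_mulPoint : Continuous fun x : UnitIoc × UnitIoc => mulPoint x.1 x.2 := by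
  unfold mulPoint
  fun_prop

/-- The average of `h` over `((1-t)p, p]`. -/
noncomputable def leftAvg (h : UnitIoc → ℝ) (t : I) (p : UnitIoc) : ℝ :=
  ∫ s, h (mulPoint p (upperPoint t s)) ∂unif

lemma measurable_mulPoint_upperPoint (t : I) (p : UnitIoc) :
    Measurable fun s => mulPoint p (upperPoint t s) :=
  (continuous_mulPoint.comp ((Continuous.prodMk_right p).comp
    (continuous_upperPoint.comp (Continuous.prodMk_right t)))).measurable

lemma mulPoint_le (p q : UnitIoc) : mulPoint p q ≤ p :=
  Subtype.coe_le_coe.1 (mul_le_of_le_one_right p.2.1.le q.2.2)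

namespace IsQuantileFn

variable {h : UnitIoc → ℝ}

lemma continuous_leftAvg (hh : IsQuantileFn h) {t : I} (ht : 0 < (t : ℝ)) :
    Continuous (leftAvg h t) := by
  refine continuous_iff_continuousAt.2 fun p => ?_
  refine hh.continuousAt_integral (measurable_mulPoint_upperPoint t)
    (fun s => continuous_mulPoint.comp (Continuous.prodMk_left _)) fun s s' hs => ?_
  have h1 : (p : ℝ) * upperPoint t s = p * upperPoint t s' := congrArg Subtype.val hs
  exact upperPoint_injective ht (Subtype.ext (mul_left_cancel₀ p.2.1.ne' h1))

lemma leftAvg_le (hh : IsQuantileFn h) (t : I) (p : UnitIoc) : leftAvg h t p ≤ h p := by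
  have h1 := integral_mono (hh.integrable (measurable_mulPoint_upperPoint t p))
    (integrable_const (μ := unif) (h p)) fun s => hh.mono (mulPoint_le p (upperPoint t s))
  simpa [leftAvg] using h1

lemma abs_leftAvg_le {c : ℝ} (hc : ∀ p, |h p| ≤ c) (t : I) (p : UnitIoc) :
    |leftAvg h t p| ≤ c := by
  have h1 := norm_integral_le_of_norm_le_const (μ := unif)
    (f := fun s => h (mulPoint p (upperPoint t s))) (Eventually.of_forall fun s => hc _)
  simpa [leftAvg] using h1

lemma tendsto_leftAvg (hh : IsQuantileFn h) {t : ℕ → I} (ht : Tendsto t atTop (𝓝 0))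
    (p : UnitIoc) : Tendsto (fun n => leftAvg h (t n) p) atTop (𝓝 (h p)) := by
  obtain ⟨c, hc⟩ := hh.bdd
  have h1 : Tendsto (fun n => leftAvg h (t n) p) atTop (𝓝 (∫ _, h p ∂unif)) := by
    refine tendsto_integral_of_dominated_convergence (fun _ => c) (fun n =>
      (hh.measurable.comp (measurable_mulPoint_upperPoint (t n) p)).aestronglyMeasurable)
      (integrable_const c) (fun n => Eventually.of_forall fun s => hc _)
      (Eventually.of_forall fun s => ?_)
    refine (hh.left_cont p).tendsto.comp (tendsto_nhdsWithin_iff.2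
      ⟨?_, Eventually.of_forall fun n => mulPoint_le _ _⟩)
    have h2 : Continuous fun u : I => mulPoint p (upperPoint u s) :=
      continuous_mulPoint.comp ((Continuous.prodMk_right p).comp (continuous_upperPoint_left s))
    have h3 := (h2.tendsto 0).comp ht
    have h4 : mulPoint p (upperPoint 0 s) = p := by
      rw [upperPoint_zero]
      exact Subtype.ext (mul_one _)
    rwa [h4] at h3
  simpa using h1

/-- Integration of a quantile function is lower semicontinuous for weak convergence. -/
lemma isClosed_integral_le (hh : IsQuantileFn h) (r : ℝ) :
    IsClosed {μ : Meas01 | ∫ p, h p ∂(μ : Measure UnitIoc) ≤ r} := by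
  obtain ⟨c, hc⟩ := hh.bdd
  let t : ℕ → I := fun n => ⟨1 / ((n : ℝ) + 1), by positivity,
    div_le_one_of_le₀ (by linarith [(n.cast_nonneg : (0 : ℝ) ≤ n)]) (by positivity)⟩
  have htpos : ∀ n, 0 < (t n : ℝ) := fun n => by
    show 0 < 1 / ((n : ℝ) + 1)
    positivity
  have ht0 : Tendsto t atTop (𝓝 0) :=
    tendsto_subtype_rng.2 tendsto_one_div_add_atTop_nhds_zero_nat
  have hcont : ∀ n, Continuous fun μ : Meas01 => ∫ p, leftAvg h (t n) p ∂(μ : Measure UnitIoc) :=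
    fun n => continuous_integral_of_bounded (hh.continuous_leftAvg (htpos n))
      (abs_leftAvg_le hc (t n))
  refine isClosed_of_closure_subset fun μ hμ => ?_
  -- Left averages are continuous minorants of `h`, so their integrals inherit the bound and keep it
  -- under weak limits. They converge pointwise to `h` by left-continuity, and dominated convergence
  -- restores `h`.
  have hle : ∀ n, ∫ p, leftAvg h (t n) p ∂(μ : Measure UnitIoc) ≤ r := fun n =>
    closure_minimal (t := {μ : Meas01 | ∫ p, leftAvg h (t n) p ∂(μ : Measure UnitIoc) ≤ r})
      (fun κ hκ => (integral_mono
        (Integrable.of_bound (hh.continuous_leftAvg (htpos n)).aestronglyMeasurable c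
          (Eventually.of_forall (abs_leftAvg_le hc (t n))))
        (hh.integrable (f := id) measurable_id) (hh.leftAvg_le (t n))).trans hκ)
      (isClosed_le (hcont n) continuous_const) hμ
  refine le_of_tendsto' (tendsto_integral_of_dominated_convergence (fun _ => c)
    (fun n => (hh.continuous_leftAvg (htpos n)).aestronglyMeasurable) (integrable_const c)
    (fun n => Eventually.of_forall (abs_leftAvg_le hc (t n)))
    (Eventually.of_forall (hh.tendsto_leftAvg ht0))) hle

end IsQuantileFn

/-! ### The conjugate functional and the largest dual set -/

lemma convex_convexProb : Convex ℝ≥0 convexProb := by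
  intro μ hμ κ hκ a b _ _ hab
  have hdist : distFun (a • μ + b • κ) = fun p => (a : ℝ) * distFun μ p + b * distFun κ p := by
    funext p
    simp only [distFun, FiniteMeasure.toMeasure_add, FiniteMeasure.toMeasure_smul]
    rw [measureReal_add_apply, measureReal_nnreal_smul_apply, measureReal_nnreal_smul_apply]
  refine ⟨(distFun_mono _).monotoneOn _, ?_, ?_⟩
  · rw [hdist]
    exact (hμ.2.1.smul a.2).add (hκ.2.1.smul b.2)
  · have h1 : (μ : Measure UnitIoc) univ = 1 := hμ.2.2
    have h2 : (κ : Measure UnitIoc) univ = 1 := hκ.2.2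
    simp only [FiniteMeasure.toMeasure_add, FiniteMeasure.toMeasure_smul, Measure.add_apply,
      Measure.smul_apply]
    rw [h1, h2]
    simp only [ENNReal.smul_def, smul_eq_mul, mul_one]
    exact_mod_cast hab

lemma quantileIntegral_combination (Z : BddMeas X) (P : ProbabilityMeasure X) (μ κ : Meas01)
    (a b : ℝ≥0) : quantileIntegral Z P (a • μ + b • κ)
      = a * quantileIntegral Z P μ + b * quantileIntegral Z P κ := by
  have hi : ∀ η : Meas01, Integrable (fun p : UnitIoc => quantile Z P p) (η : Measure UnitIoc) :=
    fun η => (isQuantileFn_quantileFn Z P).integrable (f := id) measurable_id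
  simp only [quantileIntegral, FiniteMeasure.toMeasure_add, FiniteMeasure.toMeasure_smul]
  rw [integral_add_measure ((hi μ).smul_measure_nnreal) ((hi κ).smul_measure_nnreal),
    integral_smul_nnreal_measure, integral_smul_nnreal_measure]
  rfl

lemma conjugate_le_coe_iff {μ : Meas01} {M : ℝ} :
    conjugate ρ μ ≤ M ↔ ∀ Z P, quantileIntegral Z P μ - ρ Z P ≤ M := by
  simp only [conjugate, iSup_le_iff, EReal.coe_le_coe_iff]

lemma conjugate_lt_top_iff {μ : Meas01} :
    conjugate ρ μ < ⊤ ↔ ∃ M : ℝ, ∀ Z P, quantileIntegral Z P μ - ρ Z P ≤ M := by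
  constructor
  · intro h
    obtain ⟨M, hM, -⟩ := EReal.lt_iff_exists_real_btwn.1 h
    exact ⟨M, conjugate_le_coe_iff.1 hM.le⟩
  · rintro ⟨M, hM⟩
    exact (conjugate_le_coe_iff.2 hM).trans_lt (EReal.coe_lt_top M)

lemma le_conjugate (μ : Meas01) (Z : BddMeas X) (P : ProbabilityMeasure X) :
    ((quantileIntegral Z P μ - ρ Z P : ℝ) : EReal) ≤ conjugate ρ μ :=
  le_iSup₂ (f := fun Z P => ((quantileIntegral Z P μ - ρ Z P : ℝ) : EReal)) Z P

/-- The effective domain of the conjugate among measures with convex distribution functions. -/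
def convexDomain (ρ : BddMeas X → ProbabilityMeasure X → ℝ) : Set Meas01 :=
  {μ ∈ convexProb | conjugate ρ μ < ⊤}

lemma convex_convexDomain : Convex ℝ≥0 (convexDomain ρ) := by
  rintro μ ⟨hμ, hμ'⟩ κ ⟨hκ, hκ'⟩ a b ha hb hab
  refine ⟨convex_convexProb hμ hκ ha hb hab, ?_⟩
  obtain ⟨M, hM⟩ := conjugate_lt_top_iff.1 hμ'
  obtain ⟨N, hN⟩ := conjugate_lt_top_iff.1 hκ'
  refine conjugate_lt_top_iff.2 ⟨a * M + b * N, fun Z P => ?_⟩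
  rw [quantileIntegral_combination]
  have h1 := mul_le_mul_of_nonneg_left (hM Z P) a.2
  have h2 := mul_le_mul_of_nonneg_left (hN Z P) b.2
  have h3 : (a : ℝ) + b = 1 := by exact_mod_cast hab
  have h4 : ρ Z P = a * ρ Z P + b * ρ Z P := by rw [← add_mul, h3, one_mul]
  change (a : ℝ) * _ ≤ a * _ at h1
  change (b : ℝ) * _ ≤ b * _ at h2
  linarith

lemma coe_sub_conjugate_le (μ : Meas01) (Z : BddMeas X) (P : ProbabilityMeasure X) :
    (quantileIntegral Z P μ : EReal) - conjugate ρ μ ≤ ρ Z P := by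
  refine (EReal.sub_le_sub le_rfl (le_conjugate μ Z P)).trans ?_
  rw [← EReal.coe_sub, sub_sub_cancel]

lemma le_coe_sub_conjugate {μ : Meas01} {Z : BddMeas X} {P : ProbabilityMeasure X}
    (h : ∀ V R, quantileIntegral V R μ - ρ V R ≤ quantileIntegral Z P μ - ρ Z P) :
    (ρ Z P : EReal) ≤ (quantileIntegral Z P μ : EReal) - conjugate ρ μ := by
  refine le_trans ?_ (EReal.sub_le_sub le_rfl (conjugate_le_coe_iff.2 h))
  rw [← EReal.coe_sub, sub_sub_cancel]

/-- A subgradient at `[Z,P]` attains the supremum in the conjugate at `[Z,P]`. It therefore has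
finite conjugate, lies in the domain, and attains the representation; the opposite inequality holds
for every measure. -/
lemma isDualSet_closure_convexDomain
    (hsub : ∀ Z P, ∃ μ ∈ convexProb, ∀ V R,
      quantileIntegral V R μ - ρ V R ≤ quantileIntegral Z P μ - ρ Z P) :
    IsDualSet ρ (closure (convexDomain ρ)) where
  subset_convexProb := closure_minimal (fun _ h => h.1) isClosed_convexProb
  isClosed := isClosed_closure
  convex := fun x hx y hy a b ha hb hab =>
    map_mem_closure₂ (f := fun x y : Meas01 => a • x + b • y)
      ((continuous_fst.const_smul a).add (continuous_snd.const_smul b)) hx hy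
      fun _ hx' _ hy' => convex_convexDomain hx' hy' ha hb hab
  finite_dense := closure_mono fun _ h => ⟨subset_closure h, h.2⟩
  representation := fun Z P => by
    refine le_antisymm ?_ (iSup₂_le fun μ _ => coe_sub_conjugate_le μ Z P)
    obtain ⟨μ, hμ, h⟩ := hsub Z P
    have hmem : μ ∈ closure (convexDomain ρ) :=
      subset_closure ⟨hμ, conjugate_lt_top_iff.2 ⟨_, h⟩⟩
    exact le_iSup₂_of_le μ hmem (le_coe_sub_conjugate h)

lemma IsDualSet.subset_closure_convexDomain {D : Set Meas01} (hD : IsDualSet ρ D) :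
    D ⊆ closure (convexDomain ρ) :=
  hD.finite_dense.trans (closure_mono fun _ h => ⟨hD.subset_convexProb h.1, h.2⟩)

/-! ### Positive homogeneity and the conclusion. -/

lemma PositivelyHomogeneous.quantileIntegral_le (hρ : PositivelyHomogeneous ρ) {μ : Meas01}
    (hμ : conjugate ρ μ < ⊤) (Z : BddMeas X) (P : ProbabilityMeasure X) :
    quantileIntegral Z P μ ≤ ρ Z P := by
  obtain ⟨M, hM⟩ := conjugate_lt_top_iff.1 hμ
  by_contra! hlt
  have hpos : 0 < quantileIntegral Z P μ - ρ Z P := sub_pos.2 hlt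
  -- A positive gap scales linearly with the position and eventually exceeds the bound `M`. The
  -- factor used is `n + 1` so that it is positive.
  obtain ⟨n, hn⟩ := exists_nat_gt (M / (quantileIntegral Z P μ - ρ Z P))
  have hb : (0 : ℝ) < n + 1 := by positivity
  have hq : quantileIntegral ((n + 1 : ℝ) • Z) P μ = (n + 1) * quantileIntegral Z P μ := by
    unfold quantileIntegral
    rw [← integral_const_mul]
    exact integral_congr_ae (Eventually.of_forall fun p => quantileFn_smul Z hb P p)
  have h1 := hM ((n + 1 : ℝ) • Z) P
  rw [hq, hρ Z _ hb.le P] at h1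
  rw [div_lt_iff₀ hpos] at hn
  linarith

lemma quantileFn_zero (P : ProbabilityMeasure X) (p : UnitIoc) : quantileFn 0 P p = 0 := by
  have h := quantileFn_smul 0 two_pos P p
  rw [smul_zero] at h
  linarith

/-- The upper bound passes from the domain to its closure by lower semicontinuity of quantile
integrals. The lower bound tests the supremum at the zero position, for which some `P` must exist.
-/
lemma PositivelyHomogeneous.conjugate_eq_zero (hρ : PositivelyHomogeneous ρ)
    (hnorm : Normalized ρ) (P : ProbabilityMeasure X) {μ : Meas01}
    (hμ : μ ∈ closure (convexDomain ρ)) : conjugate ρ μ = 0 := by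
  refine le_antisymm ?_ ?_
  · have h : conjugate ρ μ ≤ (0 : ℝ) := conjugate_le_coe_iff.2 fun Z P => sub_nonpos.2
      (closure_minimal (fun κ hκ => hρ.quantileIntegral_le hκ.2 Z P)
        ((isQuantileFn_quantileFn Z P).isClosed_integral_le (ρ Z P)) hμ)
    exact_mod_cast h
  · have h := le_conjugate (ρ := ρ) μ 0 P
    have h0 : quantileIntegral 0 P μ = 0 :=
      integral_eq_zero_of_ae (Eventually.of_forall (quantileFn_zero P))
    rw [h0, hnorm, sub_zero] at h
    exact_mod_cast h

end RiskForm

theorem theorem1 {X : Type*} [TopologicalSpace X] [PolishSpace X] [MeasurableSpace X]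
    [BorelSpace X] [Uncountable X]
    (ρ : RiskForm.BddMeas X → ProbabilityMeasure X → ℝ)
    (hnorm : RiskForm.Normalized ρ)
    (htrans : RiskForm.TranslationEquivariant ρ)
    (hconv : RiskForm.ComonotonicallyConvex ρ)
    (hicx : RiskForm.IcxConsistent ρ) :
    ∃! D : Set RiskForm.Meas01,
      (RiskForm.IsDualSet ρ D ∧ ∀ D' : Set RiskForm.Meas01, RiskForm.IsDualSet ρ D' → D' ⊆ D) ∧
      (RiskForm.PositivelyHomogeneous ρ → ∀ μ ∈ D, RiskForm.conjugate ρ μ = 0) := by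
  obtain ⟨e, Q, he, hQ⟩ := RiskForm.exists_map_eq_unif (X := X)
  have hD := RiskForm.isDualSet_closure_convexDomain
    (RiskForm.exists_subgradient htrans hconv hicx he hQ)
  refine ⟨closure (RiskForm.convexDomain ρ), ⟨⟨hD, fun D' hD' => hD'.subset_closure_convexDomain⟩,
    fun hρ μ hμ => hρ.conjugate_eq_zero hnorm Q hμ⟩, ?_⟩
  rintro D' ⟨⟨hD', hmax⟩, -⟩
  exact hD'.subset_closure_convexDomain.antisymm (hmax _ hD)
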